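/- A complex Hadamard matrix of order $d$ is a $d\times d$ complex matrix all of whose entries have modulus $1$ and whose rows are pairwise orthogonal in $\mathbb{C}^d$ (with its standard Hermitian inner product). Two such matrices $H_1, H_2$ are equivalent if $H_1=D_1P_1H_2P_2D_2$ for some unitary diagonal matrices $D_1,D_2$ and permutation matrices $P_1,P_2$. **Proposition (Haagerup).** Every complex Hadamard matrix of order $5$ is equivalent to the Fourier matrix $F_5$, given by $F_5(j,k)=\omega^{(j-1)(k-1)}$ for $j,k=1,\dots,5$, where $\omega=e^{2\pi i/5}$. -/

import Mathlib

/-- A complex Hadamard matrix of order `d`: all entries have modulus `1`, and distinct rows are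
orthogonal for the standard Hermitian product of `ℂ^d`, conjugate-linear in its first variable. -/
structure IsComplexHadamard {d : ℕ} (H : Matrix (Fin d) (Fin d) ℂ) : Prop where
  norm_entry : ∀ j k, ‖H j k‖ = 1
  rows_orthogonal : ∀ i j, i ≠ j → ∑ k, star (H i k) * H j k = 0

/-- Equivalence of complex Hadamard matrices: `H₁ = D₁ P₁ H₂ P₂ D₂` with unitary diagonal matrices
`D₁, D₂` (diagonal matrices with unimodular entries) and permutation matrices `P₁, P₂`. -/
def HadamardEquivalent {d : ℕ} (H₁ H₂ : Matrix (Fin d) (Fin d) ℂ) : Prop :=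
  ∃ (a b : Fin d → ℂ) (σ τ : Equiv.Perm (Fin d)),
    (∀ j, ‖a j‖ = 1) ∧ (∀ k, ‖b k‖ = 1) ∧
      H₁ = Matrix.diagonal a * σ.permMatrix ℂ * H₂ * τ.permMatrix ℂ * Matrix.diagonal b

/-- The Fourier matrix of order `d`, with entries `ω ^ (j * k)` for `ω = exp (2πi / d)`. The
indices `j, k` run over `0, …, d - 1`, so that they are the usual ones `1, …, d` shifted by one. -/
noncomputable def fourierMatrix (d : ℕ) : Matrix (Fin d) (Fin d) ℂ :=
  Matrix.of fun j k => Complex.exp (2 * Real.pi * Complex.I / d) ^ ((j : ℕ) * (k : ℕ))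

/-! Divide the columns so that one row becomes constant 1, and let x be another row. In the
orthonormal basis of normalized rows, multiplication by x is a unitary matrix U. Because all entries
are unimodular, every power of U has constant diagonal, the mean of the corresponding powers of the
entries of x. Unitarity and these diagonals, with the first column of U known, are rigid
(`moduli_system`, `constant_diagonal_dichotomy`). With Newton's identities (`exists_quintic`) they
leave two cases: x is a multiple of the five fifth roots of unity in some order, or x is an explicit
exceptional tuple.

An exceptional tuple is orthogonal to no zero-sum tuple of the first kind and to none of the second,
for arithmetic reasons, so comparison with a third row excludes it
(`IsComplexHadamard.isFifthRoots`). Once the first row and column are normalized to 1, the entries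
are fifth roots of unity, and their exponents form a difference matrix over ℤ/5. Up to permutations
that is the multiplication table (`exists_perm_eq_mul`), which gives the Fourier matrix. -/

open ComplexConjugate Matrix

/-! ### The real system for the squared moduli. -/

/-- Solution of the system satisfied by the squared moduli of the multiplication matrix. -/
theorem moduli_system {q a₂ a₃ a₄ b₂ b₃ b₄ r r' s s' t t' : ℝ} (hq : 0 < q)
    (ha₂ : 0 ≤ a₂) (ha₃ : 0 ≤ a₃) (ha₄ : 0 ≤ a₄) (hr : 0 ≤ r) (hs : 0 ≤ s) (ht : 0 ≤ t)
    (hab₂ : a₂ * b₂ = q) (hab₃ : a₃ * b₃ = q) (hab₄ : a₄ * b₄ = q)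
    (hrr : r * r' = q) (hss : s * s' = q) (htt : t * t' = q)
    (h₂₃ : a₂ * a₃ = t' * s) (h₂₄ : a₂ * a₄ = r * s') (h₃₄ : a₃ * a₄ = r' * t)
    (e₂ : a₂ + r + t' = 1) (e₃ : a₃ + r' + s = 1)
    (f₂ : b₂ + r' + t = 1) (f₄ : b₄ + s + t' = 1)
    (e₀ : 4 * q + b₂ + b₃ + b₄ = 1) :
    q = 1 / 16 ∧ s = r ∧ t = r ∧ s' = r' ∧ t' = r' ∧ r + r' = 3 / 4 := by
  have hr0 : 0 < r := lt_of_le_of_ne hr (by rintro rfl; simp at hrr; linarith)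
  have hs0 : 0 < s := lt_of_le_of_ne hs (by rintro rfl; simp at hss; linarith)
  have ht0 : 0 < t := lt_of_le_of_ne ht (by rintro rfl; simp at htt; linarith)
  have ha₂0 : 0 < a₂ := lt_of_le_of_ne ha₂ (by rintro rfl; simp at hab₂; linarith)
  have ha₃0 : 0 < a₃ := lt_of_le_of_ne ha₃ (by rintro rfl; simp at hab₃; linarith)
  have ha₄0 : 0 < a₄ := lt_of_le_of_ne ha₄ (by rintro rfl; simp at hab₄; linarith)
  obtain ⟨h, hh, rfl⟩ : ∃ h : ℝ, 0 < h ∧ q = h ^ 2 :=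
    ⟨√q, Real.sqrt_pos.2 hq, (Real.sq_sqrt hq.le).symm⟩
  obtain rfl : r' = h ^ 2 / r := by field_simp; linarith
  obtain rfl : s' = h ^ 2 / s := by field_simp; linarith
  obtain rfl : t' = h ^ 2 / t := by field_simp; linarith
  obtain rfl : b₂ = h ^ 2 / a₂ := by field_simp; linarith
  obtain rfl : b₃ = h ^ 2 / a₃ := by field_simp; linarith
  obtain rfl : b₄ = h ^ 2 / a₄ := by field_simp; linarith
  field_simp at h₂₃ h₂₄ h₃₄
  -- Multiplying `h₂₃` by `h₂₄` and eliminating `a₃ * a₄` through `h₃₄` gives the square of this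
  -- identity; positivity allows the root.
  have k₂ : a₂ * t = h * r := by
    have : (a₂ * t) ^ 2 * (a₃ * a₄ * s * r) = (h * r) ^ 2 * (a₃ * a₄ * s * r) := by
      have : (a₂ * a₃ * t) * (a₂ * s * a₄) * (t * r) = h ^ 2 * s * (h ^ 2 * r) * (t * r) := by
        rw [h₂₃, h₂₄]
      linear_combination this - (h ^ 2 * r ^ 2 * s) * h₃₄
    have := mul_right_cancel₀ (by positivity) this
    exact (pow_left_inj₀ (by positivity) (by positivity) two_ne_zero).1 this
  have k₃ : a₃ * r = h * s := by
    have : a₂ * t * (a₃ * r) = a₂ * t * (h * s) := by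
      linear_combination r * h₂₃ - h * s * k₂
    exact mul_left_cancel₀ (by positivity) this
  have k₄ : a₄ * s = h * t := by
    have : a₂ * t * (a₄ * s) = a₂ * t * (h * t) := by
      linear_combination t * h₂₄ - h * t * k₂
    exact mul_left_cancel₀ (by positivity) this
  obtain rfl : a₂ = h * r / t := by field_simp; linarith
  obtain rfl : a₃ = h * s / r := by field_simp; linarith
  obtain rfl : a₄ = h * t / s := by field_simp; linarith
  -- A row norm and a column norm now differ only by exchanging `r` and `s`.
  have hsr : s = r := by
    field_simp at e₂ f₄
    have : (s - r) * (h + t) = 0 := by linear_combination f₄ - e₂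
    rcases mul_eq_zero.1 this with h | h <;> linarith
  have hts : t = s := by
    field_simp at e₃ f₂
    have : (t - s) * (h + r) = 0 := by linear_combination f₂ - e₃
    rcases mul_eq_zero.1 this with h | h <;> linarith
  subst hsr hts
  field_simp at e₀ e₂ ⊢
  have h4 : (4 * h - 1) * (h + 1) = 0 := by linear_combination e₀
  have h4 : h = 1 / 4 := by
    rcases mul_eq_zero.1 h4 with h | h <;> linarith
  subst h4
  norm_num
  linear_combination 4 * e₂

/-! ### Multiplication operators in the basis of rows. -/

/-- The matrix of pointwise multiplication by `f`, in the basis of the rows of `R`. -/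
noncomputable def mulMatrix (R : Matrix (Fin 5) (Fin 5) ℂ) (f : Fin 5 → ℂ) :
    Matrix (Fin 5) (Fin 5) ℂ :=
  (1 / 5 : ℂ) • (R.map star * Matrix.diagonal f * Rᵀ)

theorem mulMatrix_apply (R : Matrix (Fin 5) (Fin 5) ℂ) (f : Fin 5 → ℂ) (j k : Fin 5) :
    mulMatrix R f j k = (1 / 5 : ℂ) * ∑ c, star (R j c) * f c * R k c := by
  rw [mulMatrix, Matrix.smul_apply, Matrix.mul_apply]
  simp only [Matrix.mul_diagonal, Matrix.map_apply, Matrix.transpose_apply, smul_eq_mul]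

theorem star_mul_self_of_norm_eq_one {z : ℂ} (hz : ‖z‖ = 1) : star z * z = 1 := by
  rw [Complex.star_def, Complex.conj_mul', hz]; simp

theorem mul_star_self_of_norm_eq_one {z : ℂ} (hz : ‖z‖ = 1) : z * star z = 1 := by
  rw [mul_comm, star_mul_self_of_norm_eq_one hz]

namespace IsComplexHadamard

variable {R : Matrix (Fin 5) (Fin 5) ℂ}

theorem map_star_mul_transpose (hR : IsComplexHadamard R) :
    R.map star * Rᵀ = (5 : ℂ) • (1 : Matrix (Fin 5) (Fin 5) ℂ) := by
  ext i j
  rw [Matrix.mul_apply]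
  by_cases h : i = j
  · subst h
    simp only [Matrix.map_apply, Matrix.transpose_apply,
      star_mul_self_of_norm_eq_one (hR.norm_entry _ _)]
    simp
  · simpa [h] using hR.rows_orthogonal i j h

theorem transpose_mul_map_star (hR : IsComplexHadamard R) :
    Rᵀ * R.map star = (5 : ℂ) • (1 : Matrix (Fin 5) (Fin 5) ℂ) := by
  have h : ((1 / 5 : ℂ) • R.map star) * Rᵀ = 1 := by
    rw [Matrix.smul_mul, hR.map_star_mul_transpose, smul_smul]; norm_num
  have h2 := mul_eq_one_comm.1 h
  rw [Matrix.mul_smul] at h2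
  rw [← h2, smul_smul]; norm_num

theorem mulMatrix_mul (hR : IsComplexHadamard R) (f g : Fin 5 → ℂ) :
    mulMatrix R f * mulMatrix R g = mulMatrix R (f * g) := by
  have : R.map star * Matrix.diagonal f * Rᵀ * (R.map star * Matrix.diagonal g * Rᵀ) =
      R.map star * Matrix.diagonal f * (Rᵀ * R.map star) * (Matrix.diagonal g * Rᵀ) := by
    simp only [Matrix.mul_assoc]
  simp only [mulMatrix, Matrix.smul_mul, Matrix.mul_smul, smul_smul]
  rw [this, hR.transpose_mul_map_star, Matrix.mul_smul, Matrix.mul_one, Matrix.smul_mul, smul_smul,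
    Matrix.mul_assoc, ← Matrix.mul_assoc (Matrix.diagonal f), Matrix.diagonal_mul_diagonal,
    ← Matrix.mul_assoc]
  norm_num
  rfl

theorem mulMatrix_one (hR : IsComplexHadamard R) : mulMatrix R 1 = 1 := by
  have : (Matrix.diagonal (1 : Fin 5 → ℂ)) = 1 := Matrix.diagonal_one
  rw [mulMatrix, this, Matrix.mul_one, hR.map_star_mul_transpose, smul_smul]; norm_num

/-- Unimodularity of the entries cancels `R j c` against its conjugate, so the diagonal does not
depend on `j`. -/
theorem mulMatrix_diag (hR : IsComplexHadamard R) (f : Fin 5 → ℂ) (j : Fin 5) :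
    mulMatrix R f j j = (∑ c, f c) / 5 := by
  rw [mulMatrix_apply, Finset.mul_sum, Finset.sum_div]
  refine Finset.sum_congr rfl fun c _ => ?_
  linear_combination (f c / 5) * star_mul_self_of_norm_eq_one (hR.norm_entry j c)

end IsComplexHadamard

theorem mulMatrix_conjTranspose (R : Matrix (Fin 5) (Fin 5) ℂ) (f : Fin 5 → ℂ) :
    (mulMatrix R f)ᴴ = mulMatrix R (star f) := by
  ext i j
  rw [Matrix.conjTranspose_apply, mulMatrix_apply, mulMatrix_apply]
  simp [mul_comm, mul_left_comm]

namespace IsComplexHadamard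

variable {R : Matrix (Fin 5) (Fin 5) ℂ}

theorem mulMatrix_unitary (hR : IsComplexHadamard R) {x : Fin 5 → ℂ} (hx : ∀ c, ‖x c‖ = 1) :
    mulMatrix R x * (mulMatrix R x)ᴴ = 1 := by
  rw [mulMatrix_conjTranspose, hR.mulMatrix_mul, ← hR.mulMatrix_one]
  congr 1
  ext c
  simpa using mul_star_self_of_norm_eq_one (hx c)

/-- Row 0 is the constant 1, so multiplying it by row `i` returns row `i`, a basis vector. -/
theorem mulMatrix_column_zero (hR : IsComplexHadamard R) (h0 : ∀ c, R 0 c = 1) (i j : Fin 5) :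
    mulMatrix R (R i) j 0 = if j = i then 1 else 0 := by
  have : mulMatrix R (R i) j 0 = (1 / 5 : ℂ) * (R.map star * Rᵀ) j i := by
    rw [mulMatrix_apply, Matrix.mul_apply]
    simp [h0]
  rw [this, hR.map_star_mul_transpose]
  simp [Matrix.one_apply]

end IsComplexHadamard

/-! ### Unitary matrices whose powers have constant diagonal. -/

/-- A unitary matrix of order `5` with zero diagonal, first column `e₁` and constant diagonals of
its square and its cube, as it comes from multiplication by a row. -/
theorem constant_diagonal_dichotomy {U : Matrix (Fin 5) (Fin 5) ℂ} {p κ : ℂ} (hU : U * Uᴴ = 1)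
    (hcol : ∀ j, U j 0 = if j = 1 then 1 else 0) (hd : ∀ j, U j j = 0)
    (h2 : ∀ j, (U * U) j j = p) (h3 : ∀ j, (U * U * U) j j = κ)
    (hκ : Complex.normSq κ = 9 / 4 * Complex.normSq p) :
    p = 0 ∨ (Complex.normSq p = 1 / 4 ∧ κ ^ 2 = -(9 / 2) * p ^ 3) := by
  by_cases hp : p = 0
  · exact Or.inl hp
  right
  have hU' : Uᴴ * U = 1 := mul_eq_one_comm.1 hU
  have row : ∀ i j, ∑ k, U i k * conj (U j k) = if i = j then 1 else 0 := fun i j => by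
    simpa [Matrix.mul_apply, Matrix.one_apply] using congrFun (congrFun hU i) j
  have col : ∀ i j, ∑ k, conj (U k i) * U k j = if i = j then 1 else 0 := fun i j => by
    simpa [Matrix.mul_apply, Matrix.one_apply] using congrFun (congrFun hU' i) j
  have nrow : ∀ i, ∑ k, Complex.normSq (U i k) = 1 := fun i => by
    have := row i i
    simp only [Complex.mul_conj, if_true] at this
    exact_mod_cast this
  have ncol : ∀ i, ∑ k, Complex.normSq (U k i) = 1 := fun i => by
    have := col i i
    simp only [← Complex.normSq_eq_conj_mul_self, if_true] at this
    exact_mod_cast this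
  have c0 : U 0 0 = 0 := hd 0
  have c1 : U 1 0 = 1 := by simp [hcol]
  have c2 : U 2 0 = 0 := by simp [hcol]
  have c3 : U 3 0 = 0 := by simp [hcol]
  have c4 : U 4 0 = 0 := by simp [hcol]
  have d1 := hd 1
  have d2 := hd 2
  have d3 := hd 3
  have d4 := hd 4
  have n1 := nrow 1
  simp only [Fin.sum_univ_five, c1, d1, map_one, map_zero] at n1
  have nn := fun i j => Complex.normSq_nonneg (U i j)
  -- The entry in column 0 already exhausts the norm of row 1.
  have r2 : U 1 2 = 0 := Complex.normSq_eq_zero.1 (by linarith [nn 1 2, nn 1 3, nn 1 4])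
  have r3 : U 1 3 = 0 := Complex.normSq_eq_zero.1 (by linarith [nn 1 2, nn 1 3, nn 1 4])
  have r4 : U 1 4 = 0 := Complex.normSq_eq_zero.1 (by linarith [nn 1 2, nn 1 3, nn 1 4])
  simp only [Matrix.mul_apply, Fin.sum_univ_five] at h2 h3 row col nrow ncol
  have q0 := h2 0
  have q2 := h2 2
  have q3 := h2 3
  have q4 := h2 4
  have k0 := h3 0
  have k2 := h3 2
  have k3 := h3 3
  have k4 := h3 4
  have o23 := row 2 3
  have o24 := row 2 4
  have o34 := row 3 4
  have N0 := nrow 0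
  have N2 := nrow 2
  have N3 := nrow 3
  have M2 := ncol 2
  have M4 := ncol 4
  simp only [c0, c1, c2, c3, c4, d1, d2, d3, d4, r2, r3, r4, mul_zero, zero_mul, add_zero, zero_add,
    mul_one, map_zero, Fin.reduceEq, if_false]
    at q0 q2 q3 q4 k0 k2 k3 k4 o23 o24 o34 N0 N2 N3 M2 M4
  -- The three products over 2-cycles in {2, 3, 4} have all pairwise sums equal to `p`.
  have e23 : U 2 3 * U 3 2 = p / 2 := by linear_combination (q2 + q3 - q4) / 2
  have e24 : U 2 4 * U 4 2 = p / 2 := by linear_combination (q2 + q4 - q3) / 2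
  have e34 : U 3 4 * U 4 3 = p / 2 := by linear_combination (q3 + q4 - q2) / 2
  -- The diagonal of the cube counts closed 3-walks: the two 3-cycles on {2, 3, 4}, and those
  -- through 1 → 0, whose sum is `κ` by `k0`.
  have hAB : U 2 3 * U 3 4 * U 4 2 + U 2 4 * U 4 3 * U 3 2 = 2 / 3 * κ := by
    linear_combination (k2 + k3 + k4 - k0) / 3
  have g2 : U 0 2 * U 2 1 = κ / 3 := by linear_combination k2 - hAB
  have g3 : U 0 3 * U 3 1 = κ / 3 := by linear_combination k3 - hAB
  have g4 : U 0 4 * U 4 1 = κ / 3 := by linear_combination k4 - hAB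
  have ns : ∀ {z w v : ℂ}, z * w = v → Complex.normSq z * Complex.normSq w = Complex.normSq v :=
    fun h => by rw [← map_mul, h]
  have np2 : Complex.normSq (p / 2) = Complex.normSq p / 4 := by
    rw [map_div₀]; norm_num [Complex.normSq_ofNat]
  have nκ3 : Complex.normSq (κ / 3) = Complex.normSq p / 4 := by
    rw [map_div₀, hκ]; norm_num [Complex.normSq_ofNat]; ring
  have ort : ∀ {z w u v : ℂ}, z * conj w + u * conj v = 0 →
      Complex.normSq z * Complex.normSq w = Complex.normSq u * Complex.normSq v := fun h => by
    have := congrArg Complex.normSq (eq_neg_of_add_eq_zero_left h)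
    simpa [map_mul, Complex.normSq_neg, Complex.normSq_conj] using this
  have := moduli_system (q := Complex.normSq p / 4)
    (a₂ := Complex.normSq (U 2 1)) (a₃ := Complex.normSq (U 3 1)) (a₄ := Complex.normSq (U 4 1))
    (b₂ := Complex.normSq (U 0 2)) (b₃ := Complex.normSq (U 0 3)) (b₄ := Complex.normSq (U 0 4))
    (r := Complex.normSq (U 2 3)) (r' := Complex.normSq (U 3 2))
    (s := Complex.normSq (U 3 4)) (s' := Complex.normSq (U 4 3))
    (t := Complex.normSq (U 4 2)) (t' := Complex.normSq (U 2 4))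
    (by have := Complex.normSq_pos.2 hp; positivity)
    (nn _ _) (nn _ _) (nn _ _) (nn _ _) (nn _ _) (nn _ _)
    (by rw [mul_comm, ns g2, nκ3]) (by rw [mul_comm, ns g3, nκ3]) (by rw [mul_comm, ns g4, nκ3])
    (by rw [ns e23, np2]) (by rw [ns e34, np2]) (by rw [mul_comm, ns e24, np2])
    (ort o23) (ort o24) (ort o34)
    (by linarith) (by linarith) (by linarith) (by linarith)
    (by rw [q0] at N0; linarith)
  obtain ⟨hq, hs, ht, hs', ht', hr⟩ := this
  have hp4 : Complex.normSq p = 1 / 4 := by linarith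
  refine ⟨hp4, ?_⟩
  have hrr : Complex.normSq (U 2 3) * Complex.normSq (U 3 2) = 1 / 16 := by rw [ns e23, np2, hq]
  set A := U 2 3 * U 3 4 * U 4 2
  set B := U 2 4 * U 4 3 * U 3 2
  have hA : Complex.normSq A = Complex.normSq (U 2 3) ^ 3 := by
    simp only [A, map_mul, hs, ht]; ring
  have hB : Complex.normSq B = Complex.normSq (U 3 2) ^ 3 := by
    simp only [B, map_mul, hs', ht']; ring
  have hABp : A * B = p ^ 3 / 8 := by
    have : A * B = (U 2 3 * U 3 2) * (U 3 4 * U 4 3) * (U 2 4 * U 4 2) := by ring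
    rw [this, e23, e34, e24]; ring
  have hsum : Complex.normSq A + Complex.normSq B = 9 / 32 := by
    rw [hA, hB]
    generalize Complex.normSq (U 2 3) = r at *
    generalize Complex.normSq (U 3 2) = r' at *
    obtain rfl : r' = 3 / 4 - r := by linarith
    linear_combination (-9 / 4) * hrr
  have hprod : Complex.normSq A * Complex.normSq B = 1 / 64 ^ 2 := by
    rw [hA, hB, ← mul_pow, hrr]; norm_num
  have hadd : Complex.normSq (A + B) = 1 / 4 := by
    rw [hAB, map_mul, hκ, hp4]; norm_num
  rw [Complex.normSq_add, hsum] at hadd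
  -- Since |A||B| = 1/64, this real part has the largest possible modulus, so the imaginary part
  -- vanishes.
  have hre : (A * conj B).re = -1 / 64 := by linarith
  have him : (A * conj B).im = 0 := by
    have : Complex.normSq (A * conj B) = 1 / 64 ^ 2 := by rw [map_mul, Complex.normSq_conj, hprod]
    rw [Complex.normSq_apply, hre] at this
    have : (A * conj B).im ^ 2 = 0 := by linarith
    exact pow_eq_zero_iff two_ne_zero |>.1 this
  have hAB' : A * conj B = -1 / 64 := by
    apply Complex.ext
    · rw [hre]; norm_num
    · rw [him]; norm_num
  have hBA : B * conj A = -1 / 64 := by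
    have := congrArg conj hAB'
    simp only [map_mul, Complex.conj_conj, map_div₀, map_neg, map_one, map_ofNat] at this
    rw [mul_comm, this]
  have hsumC : A * conj A + B * conj B = 9 / 32 := by
    rw [Complex.mul_conj, Complex.mul_conj, ← Complex.ofReal_add, hsum]; norm_num
  -- From `hBA` and `hAB'`, A² = -64|A|²AB and B² = -64|B|²AB, so (A + B)² = -16AB = -2p³.
  linear_combination (-9 / 4) * (A + B + 2 / 3 * κ) * hAB - 36 * hABp +
    144 * A ^ 2 * hBA + 144 * B ^ 2 * hAB' - 144 * A * B * hsumC

/-! ### The quintic whose roots are the entries of a row. -/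

/-- Newton's identities and reciprocity for five unimodular numbers with sum zero. -/
theorem exists_quintic {x : Fin 5 → ℂ} (hx : ∀ k, ‖x k‖ = 1) (hs : ∑ k, x k = 0) :
    ∃ e₂ e₃ e₅ : ℂ, ∑ k, x k ^ 2 = -2 * e₂ ∧ ∑ k, x k ^ 3 = 3 * e₃ ∧ e₃ = e₅ * conj e₂ ∧
      ‖e₅‖ = 1 ∧ (∀ k, x k ^ 5 + e₂ * x k ^ 3 - e₃ * x k ^ 2 - e₅ = 0) ∧
      (e₂ = 0 → Function.Injective x) := by
  have hx0 : ∀ k, x k ≠ 0 := fun k h => by simpa [h] using hx k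
  have hc : ∀ k, conj (x k) = (x k)⁻¹ := fun k => by
    rw [Complex.inv_def, Complex.normSq_eq_norm_sq, hx k]; simp
  have hs' := congrArg conj hs
  simp only [map_sum, hc, map_zero] at hs'
  simp only [Fin.sum_univ_five] at hs hs' ⊢
  have h0 := hx0 0
  have h1 := hx0 1
  have h2 := hx0 2
  have h3 := hx0 3
  have h4 := hx0 4
  have c0 := hc 0
  have c1 := hc 1
  have c2 := hc 2
  have c3 := hc 3
  have c4 := hc 4
  have m : ‖x 0 * x 1 * x 2 * x 3 * x 4‖ = 1 := by simp [hx]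
  -- With e₁ = e₄ = 0, the first identity evaluates the quintic at its root `a`, the second its
  -- derivative there.
  have main : ∀ a b c d e : ℂ, a + b + c + d + e = 0 →
      b * c * d * e + a * c * d * e + a * b * d * e + a * b * c * e + a * b * c * d = 0 →
      a ^ 5 + (a * b + a * c + a * d + a * e + b * c + b * d + b * e + c * d + c * e + d * e) *
        a ^ 3 - (a * b * c + a * b * d + a * b * e + a * c * d + a * c * e + a * d * e + b * c * d +
        b * c * e + b * d * e + c * d * e) * a ^ 2 - a * b * c * d * e = 0 ∧
      (a - b) * (a - c) * (a - d) * (a - e) = 5 * a ^ 4 +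
        3 * (a * b + a * c + a * d + a * e + b * c + b * d + b * e + c * d + c * e + d * e) *
        a ^ 2 - 2 * (a * b * c + a * b * d + a * b * e + a * c * d + a * c * e + a * d * e +
        b * c * d + b * c * e + b * d * e + c * d * e) * a := by
    intro a b c d e h1 h4
    constructor
    · linear_combination a ^ 4 * h1 - a * h4
    · linear_combination -4 * a ^ 3 * h1 + h4
  have hq : x 1 * x 2 * x 3 * x 4 + x 0 * x 2 * x 3 * x 4 + x 0 * x 1 * x 3 * x 4 +
      x 0 * x 1 * x 2 * x 4 + x 0 * x 1 * x 2 * x 3 = 0 := by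
    field_simp at hs'
    linear_combination hs'
  have hrec : ∀ a b c d e : ℂ, a ≠ 0 → b ≠ 0 → c ≠ 0 → d ≠ 0 → e ≠ 0 →
      (a * b * c + a * b * d + a * b * e + a * c * d + a * c * e + a * d * e +
        b * c * d + b * c * e + b * d * e + c * d * e) = a * b * c * d * e *
      (a⁻¹ * b⁻¹ + a⁻¹ * c⁻¹ + a⁻¹ * d⁻¹ + a⁻¹ * e⁻¹ + b⁻¹ * c⁻¹ + b⁻¹ * d⁻¹ + b⁻¹ * e⁻¹ +
        c⁻¹ * d⁻¹ + c⁻¹ * e⁻¹ + d⁻¹ * e⁻¹) := by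
    intro a b c d e ha hb hc hd he
    field_simp
    ring
  have hrec' := hrec _ _ _ _ _ h0 h1 h2 h3 h4
  refine ⟨x 0 * x 1 + x 0 * x 2 + x 0 * x 3 + x 0 * x 4 + x 1 * x 2 + x 1 * x 3 + x 1 * x 4 +
    x 2 * x 3 + x 2 * x 4 + x 3 * x 4, x 0 * x 1 * x 2 + x 0 * x 1 * x 3 + x 0 * x 1 * x 4 +
    x 0 * x 2 * x 3 + x 0 * x 2 * x 4 + x 0 * x 3 * x 4 + x 1 * x 2 * x 3 + x 1 * x 2 * x 4 +
    x 1 * x 3 * x 4 + x 2 * x 3 * x 4, x 0 * x 1 * x 2 * x 3 * x 4, ?_, ?_, ?_, m, ?_, ?_⟩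
  · linear_combination (x 0 + x 1 + x 2 + x 3 + x 4) * hs
  · generalize x 0 = a at *
    generalize x 1 = b at *
    generalize x 2 = c at *
    generalize x 3 = d at *
    generalize x 4 = e at *
    linear_combination (a ^ 2 + b ^ 2 + c ^ 2 + d ^ 2 + e ^ 2 - (a * b + a * c + a * d + a * e +
      b * c + b * d + b * e + c * d + c * e + d * e)) * hs
  · simp only [map_add, map_mul, c0, c1, c2, c3, c4]
    exact hrec'
  · intro k
    fin_cases k <;> simp only [Fin.zero_eta, Fin.mk_one, Fin.reduceFinMk]
    · linear_combination (main (x 0) (x 1) (x 2) (x 3) (x 4) hs hq).1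
    · linear_combination (main (x 1) (x 0) (x 2) (x 3) (x 4) (by linear_combination hs)
        (by linear_combination hq)).1
    · linear_combination (main (x 2) (x 0) (x 1) (x 3) (x 4) (by linear_combination hs)
        (by linear_combination hq)).1
    · linear_combination (main (x 3) (x 0) (x 1) (x 2) (x 4) (by linear_combination hs)
        (by linear_combination hq)).1
    · linear_combination (main (x 4) (x 0) (x 1) (x 2) (x 3) (by linear_combination hs)
        (by linear_combination hq)).1
  · intro he
    have he3 := congrArg conj he
    simp only [map_add, map_mul, c0, c1, c2, c3, c4, map_zero] at he3
    rw [he3, mul_zero] at hrec'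
    have p0 : (x 0 - x 1) * (x 0 - x 2) * (x 0 - x 3) * (x 0 - x 4) = 5 * x 0 ^ 4 := by
      linear_combination (main (x 0) (x 1) (x 2) (x 3) (x 4) hs hq).2 + 3 * x 0 ^ 2 * he -
        2 * x 0 * hrec'
    have p1 : (x 1 - x 0) * (x 1 - x 2) * (x 1 - x 3) * (x 1 - x 4) = 5 * x 1 ^ 4 := by
      linear_combination (main (x 1) (x 0) (x 2) (x 3) (x 4) (by linear_combination hs)
        (by linear_combination hq)).2 + 3 * x 1 ^ 2 * he - 2 * x 1 * hrec'
    have p2 : (x 2 - x 0) * (x 2 - x 1) * (x 2 - x 3) * (x 2 - x 4) = 5 * x 2 ^ 4 := by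
      linear_combination (main (x 2) (x 0) (x 1) (x 3) (x 4) (by linear_combination hs)
        (by linear_combination hq)).2 + 3 * x 2 ^ 2 * he - 2 * x 2 * hrec'
    have p3 : (x 3 - x 0) * (x 3 - x 1) * (x 3 - x 2) * (x 3 - x 4) = 5 * x 3 ^ 4 := by
      linear_combination (main (x 3) (x 0) (x 1) (x 2) (x 4) (by linear_combination hs)
        (by linear_combination hq)).2 + 3 * x 3 ^ 2 * he - 2 * x 3 * hrec'
    -- When e₂ = e₃ = 0 the derivative at a root is 5x⁴ ≠ 0, so no root is repeated.
    have hne : ∀ k l, k < l → x k - x l ≠ 0 := by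
      intro k l hkl h
      fin_cases k <;> fin_cases l <;> first
        | exact absurd hkl (by decide)
        | (simp only [Fin.zero_eta, Fin.mk_one, Fin.reduceFinMk] at h
           simp [h, h0, h1, h2, h3] at p0 p1 p2 p3)
    intro k l hkl
    by_contra hk
    rcases lt_or_gt_of_ne hk with h | h
    · exact hne _ _ h (sub_eq_zero.2 hkl)
    · exact hne _ _ h (sub_eq_zero.2 hkl.symm)

/-! ### Exceptional tuples and their non-orthogonality. -/

/-- Five numbers which are, up to a common unimodular factor and the order, the numbers
`1, ζ, ζ, ζ⁻¹, ζ⁻¹` with `2ζ² + ζ + 2 = 0`. -/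
def IsExceptional (x : Fin 5 → ℂ) : Prop :=
  ∃ (μ w : ℂ) (c : Fin 5) (ε : Fin 5 → ℤ), ‖μ‖ = 1 ∧ conj w = -w ∧ w ^ 2 = -15 / 16 ∧
    ∀ k, x k = μ * ((if k = c then 1 else -1 / 4) + w * ε k)

theorem exists_imaginary_sqrt : ∃ w : ℂ, conj w = -w ∧ w ^ 2 = -15 / 16 := by
  refine ⟨(√15 : ℝ) * Complex.I / 4, ?_, ?_⟩
  · simp only [map_div₀, map_mul, Complex.conj_ofReal, Complex.conj_I, map_ofNat]; ring
  · have : ((√15 : ℝ) : ℂ) ^ 2 = 15 := by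
      rw [← Complex.ofReal_pow, Real.sq_sqrt (by norm_num)]; norm_num
    rw [div_pow, mul_pow, this, Complex.I_sq]; norm_num

theorem int_eq_zero_of_add_mul_eq_zero {w : ℂ} (hw : conj w = -w) {a b : ℤ}
    (h : (a : ℂ) + w * b = 0) : a = 0 := by
  have h' := congrArg conj h
  simp only [map_add, map_mul, map_intCast, map_zero, hw] at h'
  have : (a : ℂ) = 0 := by linear_combination (h + h') / 2
  exact_mod_cast this

/-- The roots are μ and μ(-1/4 ± w) with w imaginary; the part of the zero sum free of w forces μ to
occur exactly once. -/
theorem isExceptional_of_roots {x : Fin 5 → ℂ} {μ : ℂ} (hμ : ‖μ‖ = 1) (hs : ∑ k, x k = 0)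
    (h : ∀ k, (x k - μ) * (x k ^ 2 + x k * μ / 2 + μ ^ 2) ^ 2 = 0) : IsExceptional x := by
  obtain ⟨w, hw, hw2⟩ := exists_imaginary_sqrt
  have hμ0 : μ ≠ 0 := fun h => by simp [h] at hμ
  have key : ∀ k, ∃ χ ε : ℤ, (χ = 0 ∨ χ = 1) ∧ x k = μ * ((5 * χ - 1) / 4 + w * ε) := by
    intro k
    rcases mul_eq_zero.1 (h k) with h | h
    · exact ⟨1, 0, by simp, by push_cast; linear_combination h⟩
    · have : (x k - μ * (-1 / 4 + w)) * (x k - μ * (-1 / 4 - w)) = 0 := by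
        linear_combination (pow_eq_zero_iff two_ne_zero).1 h - μ ^ 2 * hw2
      rcases mul_eq_zero.1 this with h | h
      · exact ⟨0, 1, by simp, by push_cast; linear_combination h⟩
      · exact ⟨0, -1, by simp, by push_cast; linear_combination h⟩
  choose χ ε hχ hx using key
  have hsum : ∑ k, χ k = 1 := by
    have h4 : ∀ k, x k = μ / 4 * (((5 * χ k - 1 : ℤ) : ℂ) + w * ((4 * ε k : ℤ) : ℂ)) := by
      intro k; rw [hx]; push_cast; ring
    simp only [h4, ← Finset.mul_sum] at hs
    have := (mul_eq_zero.1 hs).resolve_left (div_ne_zero hμ0 (by norm_num))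
    rw [Finset.sum_add_distrib, ← Finset.mul_sum, ← Int.cast_sum, ← Int.cast_sum] at this
    have := int_eq_zero_of_add_mul_eq_zero hw this
    rw [Finset.sum_sub_distrib, ← Finset.mul_sum] at this
    simp at this
    omega
  obtain ⟨c, hc⟩ : ∃ c, χ c = 1 := by
    by_contra! hne
    have : ∀ k, χ k = 0 := fun k => (hχ k).resolve_right (hne k)
    simp [this] at hsum
  have hrest : ∀ k, k ≠ c → χ k = 0 := by
    have : ∑ k ∈ Finset.univ.erase c, χ k = 0 := by
      have := Finset.add_sum_erase Finset.univ χ (Finset.mem_univ c)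
      omega
    intro k hk
    exact (Finset.sum_eq_zero_iff_of_nonneg fun i _ => by rcases hχ i with h | h <;> omega).1 this k
      (by simp [hk])
  refine ⟨μ, w, c, ε, hμ, hw, hw2, fun k => ?_⟩
  rw [hx k]
  split_ifs with hk
  · subst hk; rw [hc]; norm_num
  · rw [hrest k hk]; norm_num

/-- Up to the factor conj μ · ν / 16, the part of the inner product free of w is 20 or -5 plus a
multiple of 15, hence nonzero. Only integrality of the `ε` matters. -/
theorem IsExceptional.sum_conj_mul_ne_zero {x y : Fin 5 → ℂ} (hx : IsExceptional x)
    (hy : IsExceptional y) : ∑ k, conj (x k) * y k ≠ 0 := by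
  obtain ⟨μ, w, c, ε, hμ, hw, hw2, hx⟩ := hx
  obtain ⟨ν, v, c', ε', hν, hv, hv2, hy⟩ := hy
  have hμ0 : μ ≠ 0 := fun h => by simp [h] at hμ
  have hν0 : ν ≠ 0 := fun h => by simp [h] at hν
  intro h
  obtain ⟨σ, hσ⟩ : ∃ σ : ℤ, v = σ * w := by
    have : (v - w) * (v + w) = 0 := by linear_combination hv2 - hw2
    rcases mul_eq_zero.1 this with h | h
    · exact ⟨1, by push_cast; linear_combination h⟩
    · exact ⟨-1, by push_cast; linear_combination h⟩
  have hterm : ∀ k, conj (x k) * y k = conj μ * ν / 16 *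
      ((((if k = c then 4 else -1) * (if k = c' then 4 else -1) + 15 * (σ * ε k * ε' k) : ℤ) : ℂ) +
      w * ((4 * ((if k = c then 4 else -1) * (σ * ε' k) -
        (if k = c' then 4 else -1) * ε k) : ℤ) : ℂ)) := by
    intro k
    rw [hx, hy, map_mul, map_add, map_mul, hw, hσ]
    split_ifs <;> simp only [map_intCast, map_one, map_neg, map_div₀, map_ofNat] <;> push_cast <;>
      linear_combination (-conj μ * ν * ε k * σ * ε' k) * hw2
  simp only [hterm, ← Finset.mul_sum] at h
  have h := (mul_eq_zero.1 h).resolve_left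
    (div_ne_zero (mul_ne_zero (by simpa using hμ0) hν0) (by norm_num))
  rw [Finset.sum_add_distrib, ← Finset.mul_sum, ← Int.cast_sum, ← Int.cast_sum] at h
  have h := int_eq_zero_of_add_mul_eq_zero hw h
  rw [Finset.sum_add_distrib, ← Finset.mul_sum] at h
  have hcc : ∀ c c' : Fin 5, ∑ k, (if k = c then (4 : ℤ) else -1) * (if k = c' then 4 else -1) =
      if c = c' then 20 else -5 := by decide
  rw [hcc] at h
  split_ifs at h <;> omega

/-- Orthogonality would give D = ∑ ε y with |D|² = 5/3. Dividing each y by y 0 makes |D|² a product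
of integer combinations of fifth roots of unity, hence an algebraic integer, which 5/3 is not. -/
theorem IsExceptional.sum_conj_mul_ne_zero_of_pow {x y : Fin 5 → ℂ} (hx : IsExceptional x)
    (hy : ∀ k, ‖y k‖ = 1) (hs : ∑ k, y k = 0) (hpow : ∀ k, y k ^ 5 = y 0 ^ 5) :
    ∑ k, conj (x k) * y k ≠ 0 := by
  obtain ⟨μ, w, c, ε, hμ, hw, hw2, hx⟩ := hx
  have hμ0 : μ ≠ 0 := fun h => by simp [h] at hμ
  intro h
  have hy0 : ∀ k, conj (y k) * y k = 1 := fun k => by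
    rw [Complex.conj_mul', hy]; simp
  have hterm : ∀ k, conj (x k) * y k = conj μ *
      (5 / 4 * (if k = c then y k else 0) - 1 / 4 * y k - w * (ε k * y k)) := by
    intro k
    have : conj ((if k = c then 1 else -1 / 4 : ℂ)) = if k = c then 1 else -1 / 4 := by
      split_ifs <;> simp only [map_one, map_neg, map_div₀, map_ofNat]
    rw [hx, map_mul, map_add, map_mul, this, hw]
    simp only [map_intCast]
    split_ifs <;> ring
  simp only [hterm, ← Finset.mul_sum] at h
  have h := (mul_eq_zero.1 h).resolve_left (by simpa using hμ0)
  rw [Finset.sum_sub_distrib, Finset.sum_sub_distrib, ← Finset.mul_sum, ← Finset.mul_sum,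
    ← Finset.mul_sum, hs, Finset.sum_ite_eq' Finset.univ c] at h
  simp only [Finset.mem_univ, if_true] at h
  have hD : (∑ k, ε k * y k) * conj (∑ k, ε k * y k) = 5 / 3 := by
    have h' := congrArg conj h
    simp only [map_sub, map_mul, map_zero, hw, map_div₀, map_ofNat, map_one] at h'
    have := hy0 c
    set D := ∑ k, ε k * y k
    linear_combination (-16 / 15) * (5 / 4 * conj (y c) * h + w * D * h') +
      16 / 15 * D * conj D * hw2 + 5 / 3 * this
  have hint : ∀ z : ℂ, z ^ 5 = 1 → IsIntegral ℤ z := fun z hz =>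
    IsIntegral.of_pow (n := 5) (by norm_num) (by rw [hz]; exact isIntegral_one)
  have hI : IsIntegral ℤ ((5 / 3 : ℚ) : ℂ) := by
    have : ((5 / 3 : ℚ) : ℂ) = (∑ k, ε k * (y k * conj (y 0))) *
        (∑ k, ε k * conj (y k * conj (y 0))) := by
      have e1 : ∑ k, ε k * (y k * conj (y 0)) = conj (y 0) * ∑ k, ε k * y k := by
        rw [Finset.mul_sum]; exact Finset.sum_congr rfl fun k _ => by ring
      have e2 : ∑ k, ε k * conj (y k * conj (y 0)) = y 0 * conj (∑ k, ε k * y k) := by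
        rw [map_sum, Finset.mul_sum]
        exact Finset.sum_congr rfl fun k _ => by simp; ring
      rw [e1, e2]
      push_cast
      linear_combination -hD - (∑ k, ε k * y k) * conj (∑ k, ε k * y k) * hy0 0
    have hz : ∀ k, (y k * conj (y 0)) ^ 5 = 1 := fun k => by
      rw [mul_pow, hpow, ← mul_pow, mul_comm, hy0, one_pow]
    rw [this]
    refine IsIntegral.mul (IsIntegral.sum _ fun k _ => ?_) (IsIntegral.sum _ fun k _ => ?_)
    · exact (isIntegral_algebraMap (x := ε k)).mul (hint _ (hz k))
    · exact (isIntegral_algebraMap (x := ε k)).mul (hint _ (by rw [← map_pow, hz, map_one]))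
  have hI' : IsIntegral ℤ (5 / 3 : ℚ) := by
    have := (isIntegral_algebraMap_iff (R := ℤ) (A := ℚ) (B := ℂ) (x := 5 / 3)
      (algebraMap ℚ ℂ).injective).1 hI
    exact this
  obtain ⟨n, hn⟩ := IsIntegrallyClosed.isIntegral_iff.1 hI'
  have : (n : ℚ) * 3 = 5 := by
    have : (n : ℚ) = 5 / 3 := hn
    rw [this]; norm_num
  have : n * 3 = 5 := by exact_mod_cast this
  omega

/-! ### Ratios of two rows. -/

/-- Five numbers with a common fifth power, all distinct. -/
def IsFifthRoots (x : Fin 5 → ℂ) : Prop :=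
  (∀ k, x k ^ 5 = x 0 ^ 5) ∧ Function.Injective x

namespace IsComplexHadamard

theorem isFifthRoots_or_isExceptional_of_row_zero {R : Matrix (Fin 5) (Fin 5) ℂ}
    (hR : IsComplexHadamard R) (h0 : ∀ c, R 0 c = 1) :
    IsFifthRoots (R 1) ∨ IsExceptional (R 1) := by
  have hs : ∑ k, R 1 k = 0 := by simpa [h0] using hR.rows_orthogonal 0 1 (by decide)
  obtain ⟨e₂, e₃, e₅, h2, h3, hrec, hn, hpoly, hinj⟩ :=
    exists_quintic (hR.norm_entry 1) hs
  have hnorm : Complex.normSq e₃ = Complex.normSq e₂ := by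
    rw [hrec, map_mul, Complex.normSq_eq_norm_sq, hn, Complex.normSq_conj]; ring
  rcases constant_diagonal_dichotomy (U := mulMatrix R (R 1)) (p := -2 * e₂ / 5)
    (κ := 3 * e₃ / 5) (hR.mulMatrix_unitary (hR.norm_entry 1)) (hR.mulMatrix_column_zero h0 1)
    (fun j => by rw [hR.mulMatrix_diag, hs, zero_div])
    (fun j => by
      rw [hR.mulMatrix_mul, hR.mulMatrix_diag, ← h2]; simp [pow_two])
    (fun j => by
      rw [hR.mulMatrix_mul, hR.mulMatrix_mul, hR.mulMatrix_diag, ← h3]; simp [pow_succ])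
    (by
      simp only [map_div₀, map_mul, hnorm, Complex.normSq_neg, Complex.normSq_ofNat]
      ring) with h | ⟨h, h'⟩
  · left
    have he : e₂ = 0 := by linear_combination (-5 / 2) * h
    have he3 : e₃ = 0 := by rw [hrec, he]; simp
    have h5 : ∀ k, R 1 k ^ 5 = e₅ := fun k => by
      have := hpoly k
      rw [he, he3] at this
      linear_combination this
    exact ⟨fun k => by rw [h5, h5], hinj he⟩
  · right
    have he2 : Complex.normSq e₂ = 25 / 16 := by
      simp only [map_div₀, map_mul, Complex.normSq_neg, Complex.normSq_ofNat] at h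
      linarith
    have he : e₂ ≠ 0 := by rintro rfl; norm_num at he2
    have hrel : e₃ ^ 2 = 4 / 5 * e₂ ^ 3 := by linear_combination 25 / 9 * h'
    -- This μ is the simple root: e₂ = 5μ²/4, e₃ = 5μ³/4 and e₅ = μ⁵ factor the quintic as (x -
    -- μ)(x² + μx/2 + μ²)².
    obtain ⟨μ, hμ⟩ : ∃ μ, e₃ = μ * e₂ := ⟨e₃ / e₂, by field_simp⟩
    have hμe : e₂ = 5 / 4 * μ ^ 2 := by
      have : e₂ ^ 2 * (e₂ - 5 / 4 * μ ^ 2) = 0 := by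
        rw [hμ] at hrel
        linear_combination (-5 / 4) * hrel
      exact sub_eq_zero.1 ((mul_eq_zero.1 this).resolve_left (pow_ne_zero 2 he))
    have hμn : ‖μ‖ = 1 := by
      have : ‖μ‖ ^ 2 = 1 := by
        rw [← Complex.normSq_eq_norm_sq]
        rw [hμ, map_mul, he2] at hnorm
        linarith
      exact (pow_eq_one_iff_of_nonneg (norm_nonneg _) two_ne_zero).1 this
    have hμc : conj μ * μ = 1 := star_mul_self_of_norm_eq_one hμn
    have h5 : e₅ = μ ^ 5 := by
      rw [hμ, hμe] at hrec
      simp only [map_mul, map_pow, map_div₀, map_ofNat] at hrec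
      have h2 : conj μ ^ 2 * μ ^ 2 = 1 := by rw [← mul_pow, hμc, one_pow]
      linear_combination (-4 / 5 * μ ^ 2) * hrec - e₅ * h2
    refine isExceptional_of_roots hμn hs fun k => ?_
    have := hpoly k
    rw [h5, hμ, hμe] at this
    linear_combination this

theorem quotient {H : Matrix (Fin 5) (Fin 5) ℂ} (hH : IsComplexHadamard H)
    (σ : Equiv.Perm (Fin 5)) (i : Fin 5) :
    IsComplexHadamard (Matrix.of fun j k => H (σ j) k * conj (H i k)) where
  norm_entry j k := by simp [hH.norm_entry]
  rows_orthogonal a b hab := by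
    rw [← hH.rows_orthogonal (σ a) (σ b) (by simpa using hab)]
    refine Finset.sum_congr rfl fun k _ => ?_
    have := star_mul_self_of_norm_eq_one (hH.norm_entry i k)
    simp only [Matrix.of_apply, star_mul', Complex.star_def, Complex.conj_conj] at *
    linear_combination (conj (H (σ a) k) * H (σ b) k) * this

theorem isFifthRoots_or_isExceptional {H : Matrix (Fin 5) (Fin 5) ℂ} (hH : IsComplexHadamard H)
    {i j : Fin 5} (hij : i ≠ j) : IsFifthRoots (fun k => H j k * conj (H i k)) ∨
      IsExceptional (fun k => H j k * conj (H i k)) := by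
  obtain ⟨σ, h0, h1⟩ : ∃ σ : Equiv.Perm (Fin 5), σ 0 = i ∧ σ 1 = j := by
    have : ∀ i j : Fin 5, i ≠ j → (Equiv.swap 0 i * Equiv.swap 1 (Equiv.swap 0 i j)) 0 = i ∧
      (Equiv.swap 0 i * Equiv.swap 1 (Equiv.swap 0 i j)) 1 = j := by decide
    exact ⟨_, this i j hij⟩
  have := (hH.quotient σ i).isFifthRoots_or_isExceptional_of_row_zero fun c => by
    rw [Matrix.of_apply, h0]
    exact mul_star_self_of_norm_eq_one (hH.norm_entry i c)
  rw [← h1]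
  exact this

theorem isFifthRoots {H : Matrix (Fin 5) (Fin 5) ℂ} (hH : IsComplexHadamard H)
    {i j : Fin 5} (hij : i ≠ j) : IsFifthRoots (fun k => H j k * conj (H i k)) := by
  refine (hH.isFifthRoots_or_isExceptional hij).resolve_right fun hx => ?_
  -- A third row, divided by row `i`, is of one of the two types and orthogonal to the supposed
  -- exceptional ratio.
  obtain ⟨l, hil, hjl⟩ : ∃ l, i ≠ l ∧ j ≠ l :=
    (by decide : ∀ i j : Fin 5, ∃ l, i ≠ l ∧ j ≠ l) i j
  have horth : ∑ k, conj (H j k * conj (H i k)) * (H l k * conj (H i k)) = 0 := by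
    rw [← hH.rows_orthogonal j l hjl]
    refine Finset.sum_congr rfl fun k _ => ?_
    have := star_mul_self_of_norm_eq_one (hH.norm_entry i k)
    simp only [map_mul, Complex.star_def, Complex.conj_conj] at *
    linear_combination (conj (H j k) * H l k) * this
  rcases hH.isFifthRoots_or_isExceptional hil with hy | hy
  · refine hx.sum_conj_mul_ne_zero_of_pow (fun k => by simp [hH.norm_entry]) ?_ hy.1 horth
    rw [← hH.rows_orthogonal i l hil]
    exact Finset.sum_congr rfl fun k _ => mul_comm _ _
  · exact hx.sum_conj_mul_ne_zero hy horth

end IsComplexHadamard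

/-! ### Difference matrices over ℤ/5. -/

/-- Normalized orthomorphisms of the cyclic group of order `5` are linear. -/
theorem exists_eq_mul_of_injective_sub {g : Fin 5 → Fin 5} (h0 : g 0 = 0)
    (hg : Function.Injective g) (hg' : Function.Injective fun k => g k - k) :
    ∃ a, ∀ k, g k = a * k := by
  have key : ∀ b c d e : Fin 5, b ≠ 0 ∧ c ≠ 0 ∧ d ≠ 0 ∧ e ≠ 0 ∧ b ≠ c ∧ b ≠ d ∧ b ≠ e ∧ c ≠ d ∧
      c ≠ e ∧ d ≠ e ∧ b - 1 ≠ 0 ∧ c - 2 ≠ 0 ∧ d - 3 ≠ 0 ∧ e - 4 ≠ 0 ∧ b - 1 ≠ c - 2 ∧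
      b - 1 ≠ d - 3 ∧ b - 1 ≠ e - 4 ∧ c - 2 ≠ d - 3 ∧ c - 2 ≠ e - 4 ∧ d - 3 ≠ e - 4 →
      c = b * 2 ∧ d = b * 3 ∧ e = b * 4 := by decide
  have hgn : ∀ k l, k ≠ l → g k ≠ g l := fun k l h => hg.ne h
  have hgn' : ∀ k l, k ≠ l → g k - k ≠ g l - l := fun k l h => hg'.ne h
  have := key (g 1) (g 2) (g 3) (g 4) ⟨h0 ▸ hgn 1 0 (by decide), h0 ▸ hgn 2 0 (by decide),
    h0 ▸ hgn 3 0 (by decide), h0 ▸ hgn 4 0 (by decide), hgn _ _ (by decide), hgn _ _ (by decide),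
    hgn _ _ (by decide), hgn _ _ (by decide), hgn _ _ (by decide), hgn _ _ (by decide),
    by simpa [h0] using hgn' 1 0 (by decide), by simpa [h0] using hgn' 2 0 (by decide),
    by simpa [h0] using hgn' 3 0 (by decide), by simpa [h0] using hgn' 4 0 (by decide),
    hgn' _ _ (by decide), hgn' _ _ (by decide), hgn' _ _ (by decide), hgn' _ _ (by decide),
    hgn' _ _ (by decide), hgn' _ _ (by decide)⟩
  refine ⟨g 1, fun k => ?_⟩
  fin_cases k
  · simpa using h0
  · simp
  · exact this.1
  · exact this.2.1
  · exact this.2.2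

/-- A difference matrix of order `5` over the cyclic group is the multiplication table. -/
theorem exists_perm_eq_mul {L : Fin 5 → Fin 5 → Fin 5} (hrow : ∀ k, L 0 k = 0)
    (hcol : ∀ j, L j 0 = 0) (hL : ∀ i j, i ≠ j → Function.Injective fun k => L j k - L i k) :
    ∃ σ τ : Equiv.Perm (Fin 5), ∀ j k, L j k = σ j * τ k := by
  have hinj : ∀ j, j ≠ 0 → Function.Injective (L j) := fun j hj => by
    simpa [hrow] using hL 0 j hj.symm
  -- Reordering columns so that row 1 becomes the identity makes every row beyond 0 and 1 a
  -- normalized orthomorphism.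
  let τ : Equiv.Perm (Fin 5) :=
    Equiv.ofBijective (L 1) (Finite.injective_iff_bijective.1 (hinj 1 (by decide)))
  have hτ : ∀ k, L 1 (τ.symm k) = k := fun k => τ.apply_symm_apply k
  have hτ0 : τ.symm 0 = 0 := by rw [Equiv.symm_apply_eq]; exact (hcol 1).symm
  have hlin : ∀ j, ∃ a, ∀ k, L j (τ.symm k) = a * k := by
    intro j
    rcases eq_or_ne j 0 with rfl | hj0
    · exact ⟨0, fun k => by simp [hrow]⟩
    rcases eq_or_ne j 1 with rfl | hj1
    · exact ⟨1, fun k => by simp [hτ]⟩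
    refine exists_eq_mul_of_injective_sub (by rw [hτ0, hcol])
      ((hinj j hj0).comp τ.symm.injective) ?_
    have := (hL 1 j hj1.symm).comp τ.symm.injective
    simpa [Function.comp_def, hτ] using this
  choose a ha using hlin
  have hainj : Function.Injective a := by
    intro i j hij
    by_contra hne
    have := @hL i j hne (τ.symm 0) (τ.symm 1) (by simp only [ha, hij, sub_self])
    exact absurd (τ.symm.injective this) (by decide)
  refine ⟨Equiv.ofBijective a (Finite.injective_iff_bijective.1 hainj), τ, fun j k => ?_⟩
  have := ha j (τ k)
  rwa [Equiv.symm_apply_apply] at this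

/-! ### Exponents of the normalized matrix. -/

theorem proposition2p1 (H : Matrix (Fin 5) (Fin 5) ℂ) (hH : IsComplexHadamard H) :
    HadamardEquivalent H (fourierMatrix 5) := by
  have hω : IsPrimitiveRoot (Complex.exp (2 * Real.pi * Complex.I / (5 : ℕ))) 5 :=
    Complex.isPrimitiveRoot_exp 5 (by norm_num)
  set ω := Complex.exp (2 * Real.pi * Complex.I / (5 : ℕ)) with hωdef
  have hF : ∀ j k, fourierMatrix 5 j k = ω ^ ((j : ℕ) * (k : ℕ)) := fun j k => rfl
  have hu : ∀ j k, conj (H j k) * H j k = 1 := fun j k =>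
    star_mul_self_of_norm_eq_one (hH.norm_entry j k)
  -- The ratio of row j to row 0 has constant fifth power; dividing it by its value in column 0
  -- makes its entries fifth roots of unity.
  let R : Fin 5 → Fin 5 → ℂ := fun j k => H j k * conj (H 0 k) * (conj (H j 0) * H 0 0)
  have hR5 : ∀ j k, R j k ^ 5 = 1 := by
    intro j k
    rcases eq_or_ne j 0 with rfl | hj
    · have : R 0 k = 1 := by
        simp only [R]; rw [hu 0 0, mul_comm (H 0 k), hu 0 k, one_mul]
      rw [this, one_pow]
    · have h1 := (hH.isFifthRoots hj.symm).1 k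
      simp only at h1
      have : R j k ^ 5 = (conj (H j 0) * H j 0 * (conj (H 0 0) * H 0 0)) ^ 5 := by
        simp only [R]
        rw [mul_pow, h1]
        ring
      rw [this, hu, hu, one_mul, one_pow]
  have hL : ∀ j k, ∃ l : Fin 5, ω ^ (l : ℕ) = R j k := fun j k => by
    obtain ⟨l, hl, h⟩ := hω.eq_pow_of_pow_eq_one (hR5 j k)
    exact ⟨⟨l, hl⟩, h⟩
  choose L hL using hL
  have hmod : ∀ n : ℕ, ω ^ (n % 5) = ω ^ n := fun n => by
    conv_rhs => rw [← Nat.mod_add_div n 5, pow_add, pow_mul, hω.pow_eq_one, one_pow, mul_one]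
  have hLinj : ∀ l m : Fin 5, ω ^ (l : ℕ) = ω ^ (m : ℕ) → l = m := fun l m h =>
    Fin.ext (hω.pow_inj l.2 m.2 h)
  have hadd : ∀ l m : Fin 5, ω ^ ((l + m : Fin 5) : ℕ) = ω ^ (l : ℕ) * ω ^ (m : ℕ) := fun l m => by
    rw [Fin.val_add, hmod, pow_add]
  obtain ⟨σ, τ, hστ⟩ := exists_perm_eq_mul (L := L)
    (fun k => hLinj _ _ (by
      rw [hL, Fin.val_zero, pow_zero]
      linear_combination (conj (H 0 k) * H 0 k) * hu 0 0 + hu 0 k))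
    (fun j => hLinj _ _ (by
      rw [hL, Fin.val_zero, pow_zero]
      linear_combination (conj (H j 0) * H j 0) * hu 0 0 + hu j 0))
    (by
      intro i j hij k m hkm
      refine (hH.isFifthRoots hij).2 ?_
      have h := congrArg (fun l : Fin 5 => ω ^ (l : ℕ)) (sub_eq_sub_iff_add_eq_add.1 hkm)
      simp only [hadd, hL, R] at h
      have hne : ∀ a b, H a b ≠ 0 := fun a b h0 => by simpa [h0] using hu a b
      have hc : conj (H 0 k) * conj (H 0 m) * conj (H j 0) * conj (H i 0) * H 0 0 ^ 2 ≠ 0 := by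
        simp [hne]
      have h' : H j k * H i m = H j m * H i k :=
        mul_left_cancel₀ hc (by linear_combination h)
      simp only
      linear_combination conj (H i k) * conj (H i m) * h' - H j k * conj (H i k) * hu i m +
        H j m * conj (H i m) * hu i k)
  -- The diagonal factors undo the normalization; `τ` is inverted because right multiplication by a
  -- permutation matrix reindexes columns by the inverse.
  refine ⟨fun j => H j 0 * conj (H 0 0), fun k => H 0 k, σ, τ.symm, fun j => by
    simp [hH.norm_entry], fun k => hH.norm_entry 0 k, ?_⟩
  ext j k
  rw [Matrix.mul_diagonal, Matrix.mul_assoc, Matrix.mul_assoc, Matrix.diagonal_mul,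
    Equiv.Perm.permMatrix, Equiv.Perm.permMatrix, PEquiv.toMatrix_toPEquiv_mul,
    PEquiv.mul_toMatrix_toPEquiv]
  simp only [Matrix.submatrix_apply, id, Equiv.symm_symm, hF]
  have : ω ^ ((σ j : ℕ) * (τ k : ℕ)) = R j k := by
    rw [← hL, hστ, Fin.val_mul, hmod]
  rw [this]
  simp only [R]
  linear_combination (-(H j k)) * (conj (H 0 k) * H 0 k * (conj (H 0 0) * H 0 0) * hu j 0 +
    conj (H 0 k) * H 0 k * hu 0 0 + hu 0 k)
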